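/- Let $X$ be a set with a metric $d$. For $\lambda>0$ the Gaussian kernel on $X$ with parameter $\lambda$ is $k_\lambda(x,y)=\exp(-\lambda\, d(x,y)^2)$; it is called positive definite if $\sum_{i,j=1}^N c_ic_j k_\lambda(x_i,x_j)\ge 0$ for all $N\in\mathbb N$, $x_1,\dots,x_N\in X$ and $c_1,\dots,c_N\in\mathbb R$. Put $\Lambda^+(X)=\{\lambda>0 : k_\lambda \text{ is positive definite}\}$. Let $S^n$ be the unit sphere of $\mathbb R^{n+1}$ with its intrinsic metric $d_{S^n}$ (the infimum of the lengths of curves in $S^n$ joining two points). If $X$ is a metric space for which there are a real $r>0$ and a map $\iota:S^1\to X$ with $d(\iota(x),\iota(y))=r\,d_{S^1}(x,y)$ for all $x,y\in S^1$, then $\Lambda^+(X)=\varnothing$. Moreover $\Lambda^+(X)=\varnothing$ for each of the following spaces: 1. the sphere $X=S^n$ with its intrinsic metric, for every $n\ge 1$; 2. the real projective space $X=\mathbb{RP}^n=S^n/\{\pm1\}$ with its intrinsic (quotient) metric $d([x],[y])=\min\{d_{S^n}(x,y),d_{S^n}(x,-y)\}$, for every $n\ge 1$; 3. the real Grassmannian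 $X=\mathrm{Gr}_{\mathbb R}(k,n)$ of $k$-dimensional linear subspaces of $\mathbb R^n$ with the metric $d(V,W)=\big(\sum_{i=1}^k\theta_i^2\big)^{1/2}$, where $\theta_1,\dots,\theta_k\in[0,\pi/2]$ are the principal angles between $V$ and $W$, i.e. $\cos\theta_1,\dots,\cos\theta_k$ are the singular values (with multiplicity) of the orthogonal projection $V\to W$, for all $1\le k<n$. -/

import Mathlib

namespace GaussianKernel

/-- Positive definiteness of a (symmetric) real kernel: all its Gram matrices are positive
semidefinite. -/
def IsPD {X : Type*} (k : X → X → ℝ) : Prop :=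
  ∀ (N : ℕ) (x : Fin N → X) (c : Fin N → ℝ),
    0 ≤ ∑ i, ∑ j, c i * c j * k (x i) (x j)

/-- The Gaussian kernel with parameter `l` on a set with distance function `d`. -/
noncomputable def gaussian {X : Type*} (d : X → X → ℝ) (l : ℝ) (x y : X) : ℝ :=
  Real.exp (-l * d x y ^ 2)

/-- The set `Λ⁺` of parameters for which the Gaussian kernel is positive definite. -/
def LambdaPlus {X : Type*} (d : X → X → ℝ) : Set ℝ :=
  {l | 0 < l ∧ IsPD (gaussian d l)}

/-- `Y`, with its distance `d'` rescaled by the factor `r`, embeds isometrically into `(X, d)`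
(in the sense of metric spaces). -/
def ScaledEmbeds {Y X : Type*} (r : ℝ) (d' : Y → Y → ℝ) (d : X → X → ℝ) : Prop :=
  ∃ f : Y → X, ∀ x y, d (f x) (f y) = r * d' x y

/-- The intrinsic distance of a metric space: the infimum of the lengths of the
continuous paths from `x` to `y`. -/
noncomputable def intrinsicDist {X : Type*} [MetricSpace X] (x y : X) : ℝ :=
  (⨅ p : Path x y, eVariationOn p Set.univ).toReal

/-- The unit sphere `S^n` in Euclidean space `ℝ^(n+1)`. -/
abbrev Sph (n : ℕ) : Type :=
  Metric.sphere (0 : EuclideanSpace ℝ (Fin (n + 1))) 1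

/-- The intrinsic distance on `S^n`, induced by the Euclidean metric of `ℝ^(n+1)`. -/
noncomputable def sphDist (n : ℕ) : Sph n → Sph n → ℝ := intrinsicDist

/-- Real projective space `ℝP^n`: the lines through the origin in `ℝ^(n+1)`. -/
abbrev RProj (n : ℕ) : Type :=
  Projectivization ℝ (EuclideanSpace ℝ (Fin (n + 1)))

/-- The intrinsic distance on `ℝP^n = S^n / {±1}`: the quotient distance, i.e. the least intrinsic
distance in `S^n` between unit vectors representing the two lines. -/
noncomputable def rprojDist (n : ℕ) (p q : RProj n) : ℝ :=
  sInf {t | ∃ x y : Sph n, (x : EuclideanSpace ℝ (Fin (n + 1))) ∈ p.submodule ∧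
    (y : EuclideanSpace ℝ (Fin (n + 1))) ∈ q.submodule ∧ t = sphDist n x y}

/-- The real Grassmannian `Gr(k,n)` of `k`-dimensional linear subspaces of `ℝ^n`. -/
abbrev Gr (k n : ℕ) : Type :=
  {V : Submodule ℝ (EuclideanSpace ℝ (Fin n)) // Module.finrank ℝ V = k}

/-- The principal angles `θ_0 ≤ ... ≤ θ_(k-1)` between two `k`-dimensional subspaces `V`, `W`:
their cosines are the singular values of the orthogonal projection `V → W` (whose matrix in
orthonormal bases, the columns of `A` for `V` and of `B` for `W`, is `Bᵀ A`). -/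
noncomputable def principalAngle {k n : ℕ} (V W : Gr k n) (i : Fin k) : ℝ :=
  Real.arccos
    ((W.1.orthogonalProjectionOnto.toLinearMap ∘ₗ V.1.subtype).singularValues i)

/-- The geodesic distance on the Grassmannian: the `ℓ²` norm of the principal angles. -/
noncomputable def grDist (k n : ℕ) (V W : Gr k n) : ℝ :=
  Real.sqrt (∑ i : Fin k, principalAngle V W i ^ 2)

end GaussianKernel

/-!
The idea is to find a rectangle in the circle that no Gaussian kernel tolerates. A rectangle
inscribed in the unit circle has sides of arc length `h` and `π - h` and diagonals of length `π`.
Testing positive definiteness with the coefficients `1, -1, 1, -1` at its vertices gives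
`exp (-l * h ^ 2) + exp (-l * (π - h) ^ 2) ≤ 1 + exp (-l * π ^ 2)`. For small `h` the gain of
`exp (-l * (π - h) ^ 2)` over `exp (-l * π ^ 2)` is linear in `h` while the loss of
`exp (-l * h ^ 2)` against `1` is only quadratic, so the inequality fails for every `l > 0`.

Every space under consideration contains a rescaled circle. In the sphere it is a great circle:
chords and angles agree to first order, so no path is shorter than the angle between its endpoints.
In the projective space and in the Grassmannian it is a projective line, obtained by rotating one
vector of a frame and keeping the others; such a line closes up after half a turn, so it is a circle
of radius `1 / 2`.
-/

namespace GaussianKernel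

open InnerProductGeometry Module Set Topology
open scoped ENNReal NNReal InnerProductSpace

theorem IsPD.sides_le_diagonals {X : Type*} {k : X → X → ℝ} (hk : IsPD k)
    (hsymm : ∀ x y, k x y = k y x) (p q r s : X) :
    k p q + k q r + k r s + k s p ≤
      (k p p + k q q + k r r + k s s) / 2 + k p r + k q s := by
  have hquad := hk 4 ![p, q, r, s] ![1, -1, 1, -1]
  simp only [Fin.sum_univ_four, Matrix.cons_val] at hquad
  linarith [hsymm p q, hsymm q r, hsymm r s, hsymm s p, hsymm p r, hsymm q s]

theorem IsPD.comp {X Y : Type*} {k : X → X → ℝ} (hk : IsPD k) (f : Y → X) :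
    IsPD fun y y' => k (f y) (f y') :=
  fun N y c => hk N (f ∘ y) c

theorem ScaledEmbeds.lambdaPlus_eq_empty {X Y : Type*} {r : ℝ} {d : X → X → ℝ} {d' : Y → Y → ℝ}
    (h : ScaledEmbeds r d' d) (hr : r ≠ 0) (hd' : LambdaPlus d' = ∅) : LambdaPlus d = ∅ := by
  obtain ⟨f, hf⟩ := h
  refine eq_empty_of_forall_notMem fun l ⟨hl, hpd⟩ => ?_
  have hpullback : (fun y y' => gaussian d l (f y) (f y')) = gaussian d' (l * r ^ 2) := by
    ext y y'
    rw [gaussian, gaussian, hf]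
    ring_nf
  have hmem : l * r ^ 2 ∈ LambdaPlus d' := ⟨by positivity, hpullback ▸ hpd.comp f⟩
  simp [hd'] at hmem

/-- The arc length distance on the unit circle, as a function of the angular coordinates of the
two points: the distance from `s - t` to `2πℤ`. -/
noncomputable def circleDist (s t : ℝ) : ℝ :=
  Real.arccos (Real.cos (s - t))

theorem circleDist_comm (s t : ℝ) : circleDist s t = circleDist t s := by
  rw [circleDist, circleDist, ← Real.cos_neg, neg_sub]

theorem circleDist_eq_of_cos_eq {s t u : ℝ} (hu : u ∈ Icc 0 Real.pi)
    (h : Real.cos (s - t) = Real.cos u) : circleDist s t = u := by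
  rw [circleDist, h, Real.arccos_cos hu.1 hu.2]

/- With `A = exp (-l * L ^ 2) < 1`, the inequality `1 + x ≤ exp x` bounds the right side minus the
left side from below by `2 * l * L * A * h - l * (1 + A) * h ^ 2`, which is positive at
`h = L * A`. -/
theorem exists_one_add_exp_lt {l L : ℝ} (hl : 0 < l) (hL : 0 < L) :
    ∃ h ∈ Ioo 0 L, 1 + Real.exp (-l * L ^ 2) <
      Real.exp (-l * h ^ 2) + Real.exp (-l * (L - h) ^ 2) := by
  set A := Real.exp (-l * L ^ 2) with hA
  have : 0 < A := Real.exp_pos _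
  have hA1 : A < 1 := Real.exp_lt_one_iff.2 (by nlinarith [mul_pos hl (pow_pos hL 2)])
  have hside : 1 - l * (L * A) ^ 2 ≤ Real.exp (-l * (L * A) ^ 2) := by
    linarith [Real.add_one_le_exp (-l * (L * A) ^ 2)]
  have hother : A * (1 + l * (2 * L * (L * A) - (L * A) ^ 2)) ≤
      Real.exp (-l * (L - L * A) ^ 2) := by
    have hfactor : Real.exp (-l * (L - L * A) ^ 2) =
        A * Real.exp (l * (2 * L * (L * A) - (L * A) ^ 2)) := by
      rw [hA, ← Real.exp_add]
      ring_nf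
    rw [hfactor, add_comm]
    gcongr
    exact Real.add_one_le_exp _
  have hgain : 0 < l * L ^ 2 * A ^ 2 * (1 - A) := by
    have := sub_pos.2 hA1
    positivity
  exact ⟨L * A, ⟨by positivity, by nlinarith⟩, by linarith⟩

theorem lambdaPlus_circleDist : LambdaPlus circleDist = ∅ := by
  refine eq_empty_of_forall_notMem fun l ⟨hl, hpd⟩ => ?_
  have hpi := Real.pi_pos
  obtain ⟨h, ⟨h0, hlt⟩, hexp⟩ := exists_one_add_exp_lt hl hpi
  have hself : ∀ t, circleDist t t = 0 := fun t =>
    circleDist_eq_of_cos_eq ⟨le_rfl, hpi.le⟩ (by simp)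
  have hshort : ∀ t, circleDist t (t + h) = h := fun t =>
    circleDist_eq_of_cos_eq ⟨h0.le, hlt.le⟩ (by simp)
  have hdiag : ∀ t, circleDist t (t + Real.pi) = Real.pi := fun t =>
    circleDist_eq_of_cos_eq ⟨hpi.le, le_rfl⟩ (by simp)
  have hlong : circleDist h Real.pi = Real.pi - h :=
    circleDist_eq_of_cos_eq ⟨by linarith, by linarith⟩ (by rw [← Real.cos_neg, neg_sub])
  have hlong' : circleDist (Real.pi + h) 0 = Real.pi - h :=
    circleDist_eq_of_cos_eq ⟨by linarith, by linarith⟩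
      (by rw [sub_zero, add_comm, Real.cos_add_pi, Real.cos_pi_sub])
  have hrect := hpd.sides_le_diagonals (fun s t => by rw [gaussian, gaussian, circleDist_comm])
    0 h Real.pi (Real.pi + h)
  have hshort₀ := hshort 0
  have hdiag₀ := hdiag 0
  have hdiag₁ := hdiag h
  rw [zero_add] at hshort₀ hdiag₀
  rw [add_comm] at hdiag₁
  simp only [gaussian, hself, hshort, hshort₀, hdiag₀, hdiag₁, hlong, hlong'] at hrect
  norm_num at hrect
  norm_num at hexp
  linarith

section PathLength

variable {X : Type*} [PseudoEMetricSpace X]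

theorem le_mul_eVariationOn_path_of_locally {ρ : X → X → ℝ≥0∞} {C : ℝ≥0∞}
    (hself : ∀ x, ρ x x = 0) (htriangle : ∀ x y z, ρ x z ≤ ρ x y + ρ y z)
    (hlocal : ∀ z, ∃ U ∈ 𝓝 z, ∀ x ∈ U, ∀ y ∈ U, ρ x y ≤ C * edist x y) {x y : X} (p : Path x y) :
    ρ x y ≤ C * eVariationOn p univ := by
  choose U hU hρU using hlocal
  have hcover : (univ : Set unitInterval) ⊆ ⋃ z, p ⁻¹' interior (U z) := fun t _ =>
    mem_iUnion.2 ⟨p t, mem_interior_iff_mem_nhds.2 (hU (p t))⟩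
  obtain ⟨t, ht0, hmono, ⟨n, htn⟩, hsub⟩ := exists_monotone_Icc_subset_open_cover_unitInterval
    (fun z => isOpen_interior.preimage p.continuous) hcover
  have hstep : ∀ i, ρ (p (t i)) (p (t (i + 1))) ≤ C * edist (p (t (i + 1))) (p (t i)) := fun i => by
    obtain ⟨z, hz⟩ := hsub i
    rw [edist_comm]
    exact hρU z _ (interior_subset (hz (left_mem_Icc.2 (hmono i.le_succ))))
      _ (interior_subset (hz (right_mem_Icc.2 (hmono i.le_succ))))
  have hchain : ∀ m, ρ (p (t 0)) (p (t m)) ≤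
      ∑ i ∈ Finset.range m, ρ (p (t i)) (p (t (i + 1))) := fun m => by
    induction m with
    | zero => simp [hself]
    | succ m ih =>
      rw [Finset.sum_range_succ]
      exact (htriangle _ (p (t m)) _).trans (by gcongr)
  calc ρ x y = ρ (p (t 0)) (p (t n)) := by simp [ht0, htn n le_rfl]
    _ ≤ ∑ i ∈ Finset.range n, ρ (p (t i)) (p (t (i + 1))) := hchain n
    _ ≤ ∑ i ∈ Finset.range n, C * edist (p (t (i + 1))) (p (t i)) :=
      Finset.sum_le_sum fun i _ => hstep i
    _ = C * ∑ i ∈ Finset.range n, edist (p (t (i + 1))) (p (t i)) := by rw [Finset.mul_sum]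
    _ ≤ C * eVariationOn p univ := by gcongr; exact eVariationOn.sum_le hmono fun _ => mem_univ _

theorem iInf_eVariationOn_path_le_of_lipschitzWith {f : ℝ → X} {K : ℝ≥0} (hf : LipschitzWith K f)
    {a b : ℝ} (hab : a ≤ b) :
    ⨅ p : Path (f a) (f b), eVariationOn p univ ≤ K * ENNReal.ofReal (b - a) := by
  have hmono : Monotone (Path.segment a b) := fun s t hst => by
    simp only [Path.segment_apply, AffineMap.lineMap_apply_ring']
    have := sub_nonneg.2 hab
    gcongr
  have hlength : eVariationOn (Path.segment a b) univ = ENNReal.ofReal (b - a) := by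
    simpa [← unitInterval.univ_eq_Icc] using
      (hmono.monotoneOn univ).eVariationOn_eq (mem_univ 0) (mem_univ 1)
  rw [← hlength]
  exact (iInf_le _ ((Path.segment a b).map hf.continuous)).trans
    (hf.lipschitzOnWith.comp_eVariationOn_le (mapsTo_univ _ _))

end PathLength

section Orthonormal

variable {𝕜 E : Type*} [RCLike 𝕜] [NormedAddCommGroup E] [InnerProductSpace 𝕜 E]

theorem orthonormal_pair_iff {e f : E} :
    Orthonormal 𝕜 ![e, f] ↔ ‖e‖ = 1 ∧ ‖f‖ = 1 ∧ ⟪e, f⟫_𝕜 = 0 := by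
  simp [orthonormal_vecCons_iff, and_comm]

theorem orthonormal_pair {ι : Type*} {v : ι → E} (hv : Orthonormal 𝕜 v) {i j : ι} (hij : i ≠ j) :
    Orthonormal 𝕜 ![v i, v j] :=
  orthonormal_pair_iff.2 ⟨hv.norm_eq_one i, hv.norm_eq_one j, hv.inner_eq_zero hij⟩

theorem exists_orthonormal [FiniteDimensional 𝕜 E] {m : ℕ} (hm : m ≤ finrank 𝕜 E) :
    ∃ v : Fin m → E, Orthonormal 𝕜 v :=
  ⟨_, (stdOrthonormalBasis 𝕜 E).orthonormal.comp _ (Fin.castLE_injective hm)⟩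

theorem exists_orthonormal_pair [FiniteDimensional 𝕜 E] (hE : 1 < finrank 𝕜 E) :
    ∃ e f : E, Orthonormal 𝕜 ![e, f] := by
  obtain ⟨v, hv⟩ := exists_orthonormal (m := 2) hE
  exact ⟨v 0, v 1, orthonormal_pair hv zero_ne_one⟩

end Orthonormal

section Sphere

variable {E : Type*} [NormedAddCommGroup E] [InnerProductSpace ℝ E]

theorem angle_eq_arccos_inner {x y : E} (hx : ‖x‖ = 1) (hy : ‖y‖ = 1) :
    angle x y = Real.arccos ⟪x, y⟫_ℝ := by
  rw [angle, hx, hy, mul_one, div_one]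

theorem angle_eq_two_mul_arcsin {x y : E} (hx : ‖x‖ = 1) (hy : ‖y‖ = 1) :
    angle x y = 2 * Real.arcsin (dist x y / 2) := by
  have h0 := angle_nonneg x y
  have hpi := angle_le_pi x y
  have hsin : 0 ≤ Real.sin (angle x y / 2) :=
    Real.sin_nonneg_of_nonneg_of_le_pi (by linarith) (by linarith)
  have hdist : dist x y / 2 = Real.sin (angle x y / 2) := by
    have hcos := norm_sub_sq_eq_norm_sq_add_norm_sq_sub_two_mul_norm_mul_norm_mul_cos_angle x y
    rw [hx, hy] at hcos
    rw [dist_eq_norm, ← sq_eq_sq₀ (by positivity) hsin, Real.sin_sq_eq_half_sub,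
      mul_div_cancel₀ _ two_ne_zero]
    linarith
  rw [hdist, Real.arcsin_sin (by linarith) (by linarith)]
  ring

theorem exists_nhds_angle_le_mul_edist {C : ℝ≥0} (hC : 1 < C) (z : Metric.sphere (0 : E) 1) :
    ∃ U ∈ 𝓝 z, ∀ x ∈ U, ∀ y ∈ U, ENNReal.ofReal (angle (x : E) y) ≤ C * edist x y := by
  obtain ⟨s, hs, hlip⟩ : ∃ s ∈ 𝓝 (0 : ℝ), LipschitzOnWith C Real.arcsin s :=
    (Real.hasStrictDerivAt_arcsin (by norm_num) (by norm_num)).hasStrictFDerivAt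
      |>.exists_lipschitzOnWith_of_nnnorm_lt C (by simpa using hC)
  have hhalf : Filter.Tendsto (fun q : Metric.sphere (0 : E) 1 × Metric.sphere (0 : E) 1 =>
      dist q.1 q.2 / 2) (𝓝 (z, z)) (𝓝 0) :=
    Continuous.tendsto' (by fun_prop) _ _ (by simp)
  rw [nhds_prod_eq] at hhalf
  obtain ⟨U, hU, hUs⟩ := Filter.mem_prod_same_iff.1 (hhalf hs)
  refine ⟨U, hU, fun x hx y hy => ?_⟩
  have harcsin := hlip.dist_le_mul (dist x y / 2) (hUs (mk_mem_prod hx hy)) 0 (mem_of_mem_nhds hs)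
  rw [Real.arcsin_zero, dist_zero_right, dist_zero_right,
    Real.norm_of_nonneg (r := dist x y / 2) (by positivity)] at harcsin
  have hangle : angle (x : E) y ≤ C * dist x y := by
    rw [angle_eq_two_mul_arcsin (by simp) (by simp), ← Subtype.dist_eq]
    linarith [Real.le_norm_self (Real.arcsin (dist x y / 2))]
  calc ENNReal.ofReal (angle (x : E) y) ≤ ENNReal.ofReal (C * dist x y) := by gcongr
    _ = C * edist x y := by
      rw [ENNReal.ofReal_mul C.coe_nonneg, ENNReal.ofReal_coe_nnreal, edist_dist]

theorem angle_le_eVariationOn_path {x y : Metric.sphere (0 : E) 1} (p : Path x y) :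
    ENNReal.ofReal (angle (x : E) y) ≤ eVariationOn p univ := by
  suffices hC : ∀ C : ℝ≥0, 1 < C → ENNReal.ofReal (angle (x : E) y) ≤ C * eVariationOn p univ by
    refine ge_of_tendsto (x := 𝓝[>] (1 : ℝ≥0)) (f := fun C : ℝ≥0 => C * eVariationOn p univ) ?_
      (eventually_mem_nhdsWithin.mono hC)
    simpa using ENNReal.Tendsto.mul_const (b := eVariationOn p univ)
      (ENNReal.tendsto_coe.2 (Filter.tendsto_id.mono_left nhdsWithin_le_nhds)) (Or.inl one_ne_zero)
  intro C hC
  refine le_mul_eVariationOn_path_of_locally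
    (ρ := fun u v : Metric.sphere (0 : E) 1 => ENNReal.ofReal (angle (u : E) v)) (fun u => ?_)
    (fun u v w => ?_) (exists_nhds_angle_le_mul_edist hC) p
  · simp [angle_self (ne_zero_of_mem_unit_sphere u)]
  · rw [← ENNReal.ofReal_add (angle_nonneg _ _) (angle_nonneg _ _)]
    exact ENNReal.ofReal_le_ofReal (angle_le_angle_add_angle _ _ _)

/-- The point at angle `t` on the circle that starts at `e` in the direction of `f`; a great circle
of the unit sphere when `e` and `f` are orthonormal. -/
noncomputable def circleVec (e f : E) (t : ℝ) : E :=
  Real.cos t • e + Real.sin t • f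

variable {e f : E}

theorem inner_circleVec (h : Orthonormal ℝ ![e, f]) (s t : ℝ) :
    ⟪circleVec e f s, circleVec e f t⟫_ℝ = Real.cos (s - t) := by
  obtain ⟨he, hf, hef⟩ := orthonormal_pair_iff.1 h
  simp only [circleVec, inner_add_left, inner_add_right, real_inner_smul_left,
    real_inner_smul_right, real_inner_self_eq_norm_sq, he, hf, hef, real_inner_comm e f,
    Real.cos_sub]
  ring

theorem norm_circleVec (h : Orthonormal ℝ ![e, f]) (t : ℝ) : ‖circleVec e f t‖ = 1 := by
  rw [norm_eq_sqrt_real_inner, inner_circleVec h, sub_self, Real.cos_zero, Real.sqrt_one]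

/-- The great circle through the orthonormal vectors `e` and `f`, as a curve in the unit sphere. -/
noncomputable def greatCircle (h : Orthonormal ℝ ![e, f]) (t : ℝ) : Metric.sphere (0 : E) 1 :=
  ⟨circleVec e f t, by simp [norm_circleVec h]⟩

theorem lipschitzWith_greatCircle (h : Orthonormal ℝ ![e, f]) :
    LipschitzWith 1 (greatCircle h) := by
  refine LipschitzWith.of_dist_le_mul fun s t => ?_
  have hchord : ‖circleVec e f s - circleVec e f t‖ ^ 2 ≤ |s - t| ^ 2 := by
    rw [norm_sub_sq_real, norm_circleVec h, norm_circleVec h, inner_circleVec h, sq_abs]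
    linarith [Real.one_sub_sq_div_two_le_cos (x := s - t)]
  rw [NNReal.coe_one, one_mul, Subtype.dist_eq, dist_eq_norm, Real.dist_eq]
  exact (sq_le_sq₀ (norm_nonneg _) (abs_nonneg _)).1 hchord

theorem exists_norm_eq_one_inner_eq_zero (hE : 1 < Module.rank ℝ E) (x : E) :
    ∃ f : E, ‖f‖ = 1 ∧ ⟪x, f⟫_ℝ = 0 := by
  have hne : (ℝ ∙ x)ᗮ ≠ ⊥ := fun hbot => by
    have hle := rank_span_le (R := ℝ) {x}
    rw [Submodule.orthogonal_eq_bot_iff.1 hbot, rank_top, Cardinal.mk_singleton] at hle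
    exact hle.not_gt hE
  have := Submodule.nontrivial_iff_ne_bot.2 hne
  obtain ⟨f, hf⟩ := exists_norm_eq (ℝ ∙ x)ᗮ zero_le_one
  exact ⟨f, by simpa using hf, Submodule.mem_orthogonal_singleton_iff_inner_right.1 f.2⟩

theorem exists_greatCircle (hE : 1 < Module.rank ℝ E) (x y : Metric.sphere (0 : E) 1) :
    ∃ (f : E) (h : Orthonormal ℝ ![(x : E), f]),
      greatCircle h 0 = x ∧ greatCircle h (angle (x : E) y) = y := by
  have hx : ‖(x : E)‖ = 1 := by simp
  have hy : ‖(y : E)‖ = 1 := by simp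
  have hcos : Real.cos (angle (x : E) y) = ⟪(x : E), y⟫_ℝ := by simp [cos_angle, hx, hy]
  set w : E := y - Real.cos (angle (x : E) y) • (x : E) with hw
  have hxw : ⟪(x : E), w⟫_ℝ = 0 := by
    simp [hw, inner_sub_right, real_inner_smul_right, hcos, hx]
  have hsin : ‖w‖ = Real.sin (angle (x : E) y) := by
    rw [← sq_eq_sq₀ (norm_nonneg _) (sin_angle_nonneg _ _), hw, norm_sub_sq_real,
      real_inner_smul_right, norm_smul, hx, hy, Real.sin_sq, real_inner_comm, ← hcos,
      Real.norm_eq_abs]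
    ring_nf
    rw [sq_abs]
    ring
  obtain ⟨f, hf, hxf, hwf⟩ : ∃ f : E, ‖f‖ = 1 ∧ ⟪(x : E), f⟫_ℝ = 0 ∧ ‖w‖ • f = w := by
    rcases eq_or_ne w 0 with hw0 | hw0
    · obtain ⟨f, hf, hxf⟩ := exists_norm_eq_one_inner_eq_zero hE (x : E)
      exact ⟨f, hf, hxf, by simp [hw0]⟩
    · exact ⟨‖w‖⁻¹ • w, norm_smul_inv_norm hw0, by rw [real_inner_smul_right, hxw, mul_zero],
        smul_inv_smul₀ (norm_ne_zero_iff.2 hw0) w⟩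
  refine ⟨f, orthonormal_pair_iff.2 ⟨hx, hf, hxf⟩, ?_, ?_⟩ <;> ext1
  · simp [greatCircle, circleVec]
  · change Real.cos (angle (x : E) y) • (x : E) + Real.sin (angle (x : E) y) • f = y
    rw [← hsin, hwf, hw, add_sub_cancel]

theorem intrinsicDist_sphere (hE : 1 < Module.rank ℝ E) (x y : Metric.sphere (0 : E) 1) :
    intrinsicDist x y = angle (x : E) y := by
  have hlength : ⨅ p : Path x y, eVariationOn p univ = ENNReal.ofReal (angle (x : E) y) := by
    refine le_antisymm ?_ (le_iInf angle_le_eVariationOn_path)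
    obtain ⟨f, h, hx, hy⟩ := exists_greatCircle hE x y
    have hle := iInf_eVariationOn_path_le_of_lipschitzWith (lipschitzWith_greatCircle h)
      (angle_nonneg (x : E) y)
    rwa [hx, hy, ENNReal.coe_one, one_mul, sub_zero] at hle
  rw [intrinsicDist, hlength, ENNReal.toReal_ofReal (angle_nonneg _ _)]

end Sphere

theorem arccos_abs_cos (t : ℝ) :
    Real.arccos |Real.cos t| = Real.arccos (Real.cos (2 * t)) / 2 := by
  set θ := Real.arccos |Real.cos t|
  have hθ0 : 0 ≤ θ := Real.arccos_nonneg _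
  have hθle : θ ≤ Real.pi / 2 := Real.arccos_le_pi_div_two.2 (abs_nonneg _)
  have hcos : Real.cos θ = |Real.cos t| :=
    Real.cos_arccos (by linarith [abs_nonneg (Real.cos t)]) (Real.abs_cos_le_one t)
  have hdouble : Real.cos (2 * t) = Real.cos (2 * θ) := by
    rw [Real.cos_two_mul, Real.cos_two_mul, hcos, sq_abs]
  rw [hdouble, Real.arccos_cos (by linarith) (by linarith), mul_div_cancel_left₀ _ two_ne_zero]

theorem scaledEmbeds_circleDist_of_arccos_abs_cos {X : Type*} {d : X → X → ℝ} (γ : ℝ → X)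
    (h : ∀ a b, d (γ a) (γ b) = Real.arccos |Real.cos (a - b)|) :
    ScaledEmbeds (1 / 2) circleDist d := by
  refine ⟨fun t => γ (t / 2), fun s t => ?_⟩
  rw [h, arccos_abs_cos, circleDist]
  ring_nf

section SphereAndProjectiveSpace

variable {n : ℕ}

theorem one_lt_finrank_euclideanSpace (hn : 1 ≤ n) :
    1 < finrank ℝ (EuclideanSpace ℝ (Fin (n + 1))) := by
  rw [finrank_euclideanSpace_fin]
  lia

theorem sphDist_eq_arccos_inner (hn : 1 ≤ n) (x y : Sph n) :
    sphDist n x y = Real.arccos ⟪(x : EuclideanSpace ℝ (Fin (n + 1))), y⟫_ℝ := by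
  have hrank : 1 < Module.rank ℝ (EuclideanSpace ℝ (Fin (n + 1))) := by
    rw [← finrank_eq_rank]
    exact_mod_cast one_lt_finrank_euclideanSpace hn
  rw [sphDist, intrinsicDist_sphere hrank, angle_eq_arccos_inner (by simp) (by simp)]

theorem lambdaPlus_sphDist (hn : 1 ≤ n) : LambdaPlus (sphDist n) = ∅ := by
  obtain ⟨e, f, h⟩ := exists_orthonormal_pair (𝕜 := ℝ) (one_lt_finrank_euclideanSpace hn)
  have hembeds : ScaledEmbeds 1 circleDist (sphDist n) := ⟨greatCircle h, fun s t => by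
    rw [sphDist_eq_arccos_inner hn, one_mul]
    exact congrArg Real.arccos (inner_circleVec h s t)⟩
  exact hembeds.lambdaPlus_eq_empty one_ne_zero lambdaPlus_circleDist

theorem eq_or_eq_neg_of_mem_span_singleton {E : Type*} [NormedAddCommGroup E] [NormedSpace ℝ E]
    {v x : E} (hv : ‖v‖ = 1) (hx : ‖x‖ = 1) (h : x ∈ ℝ ∙ v) : x = v ∨ x = -v := by
  obtain ⟨c, rfl⟩ := Submodule.mem_span_singleton.1 h
  rw [norm_smul, hv, mul_one, Real.norm_eq_abs] at hx
  rcases eq_or_eq_neg_of_abs_eq hx with rfl | rfl <;> simp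

theorem rprojDist_mk (hn : 1 ≤ n) (x y : Sph n) :
    rprojDist n (Projectivization.mk ℝ (x : EuclideanSpace ℝ (Fin (n + 1)))
        (ne_zero_of_mem_unit_sphere x))
      (Projectivization.mk ℝ (y : EuclideanSpace ℝ (Fin (n + 1))) (ne_zero_of_mem_unit_sphere y)) =
      Real.arccos |⟪(x : EuclideanSpace ℝ (Fin (n + 1))), y⟫_ℝ| := by
  simp only [rprojDist, Projectivization.submodule_mk, sphDist_eq_arccos_inner hn]
  refine IsLeast.csInf_eq ⟨?_, ?_⟩
  · have hy := Submodule.mem_span_singleton_self (R := ℝ) (y : EuclideanSpace ℝ (Fin (n + 1)))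
    have hx := Submodule.mem_span_singleton_self (R := ℝ) (x : EuclideanSpace ℝ (Fin (n + 1)))
    rcases abs_choice ⟪(x : EuclideanSpace ℝ (Fin (n + 1))), y⟫_ℝ with habs | habs
    · exact ⟨x, y, hx, hy, by rw [habs]⟩
    · exact ⟨-x, y, neg_mem hx, hy, by rw [habs, coe_neg_sphere, inner_neg_left]⟩
  · rintro _ ⟨x', y', hx', hy', rfl⟩
    have habs : |⟪(x' : EuclideanSpace ℝ (Fin (n + 1))), y'⟫_ℝ| =
        |⟪(x : EuclideanSpace ℝ (Fin (n + 1))), y⟫_ℝ| := by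
      rcases eq_or_eq_neg_of_mem_span_singleton (by simp) (by simp) hx' with h | h <;>
      rcases eq_or_eq_neg_of_mem_span_singleton (by simp) (by simp) hy' with h' | h' <;>
      simp [h, h']
    exact habs ▸ Real.antitone_arccos (le_abs_self _)

theorem lambdaPlus_rprojDist (hn : 1 ≤ n) : LambdaPlus (rprojDist n) = ∅ := by
  obtain ⟨e, f, h⟩ := exists_orthonormal_pair (𝕜 := ℝ) (one_lt_finrank_euclideanSpace hn)
  have hembeds := scaledEmbeds_circleDist_of_arccos_abs_cos (d := rprojDist n)
    (fun a => Projectivization.mk ℝ _ (ne_zero_of_mem_unit_sphere (greatCircle h a))) fun a b => by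
      rw [rprojDist_mk hn]
      exact congrArg (fun c => Real.arccos |c|) (inner_circleVec h a b)
  exact hembeds.lambdaPlus_eq_empty (by norm_num) lambdaPlus_circleDist

end SphereAndProjectiveSpace

section SingularValues

theorem roots_charpoly_of_apply_basis {R M ι : Type*} [CommRing R] [IsDomain R] [AddCommGroup M]
    [Module R M] [Module.Free R M] [Module.Finite R M] [Fintype ι] (T : M →ₗ[R] M)
    (b : Basis ι R M) (μ : ι → R) (hT : ∀ i, T (b i) = μ i • b i) :
    T.charpoly.roots = Finset.univ.val.map μ := by
  classical
  have hdiag : LinearMap.toMatrix b b T = Matrix.diagonal μ := by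
    ext i j
    rw [LinearMap.toMatrix_apply, hT, map_smul, Finsupp.smul_apply, Basis.repr_self,
      Matrix.diagonal_apply]
    by_cases h : i = j
    · subst h; simp
    · simp [h]
  rw [← LinearMap.charpoly_toMatrix T b, hdiag, Matrix.charpoly_diagonal]
  simpa only [Multiset.map_map] using!
    Polynomial.roots_multiset_prod_X_sub_C (Finset.univ.val.map μ)

variable {𝕜 E F : Type*} [RCLike 𝕜] [NormedAddCommGroup E] [InnerProductSpace 𝕜 E]
  [FiniteDimensional 𝕜 E] [NormedAddCommGroup F] [InnerProductSpace 𝕜 F] [FiniteDimensional 𝕜 F]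

theorem adjoint_apply_of_apply_orthonormal {ι : Type*} [Fintype ι] {T : E →ₗ[𝕜] F}
    (b : OrthonormalBasis ι 𝕜 E) {c : ι → F} (hc : Orthonormal 𝕜 c) {s : ι → 𝕜}
    (hT : ∀ i, T (b i) = s i • c i) (i : ι) : T.adjoint (c i) = star (s i) • b i := by
  classical
  refine InnerProductSpace.ext_inner_right_basis b.toBasis fun j => ?_
  rw [LinearMap.adjoint_inner_left, OrthonormalBasis.coe_toBasis, hT, inner_smul_left,
    inner_smul_right, orthonormal_iff_ite.1 hc, b.inner_eq_ite]
  by_cases h : i = j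
  · subst h; simp
  · simp [h]

theorem map_singularValues_of_apply_orthonormal {k : ℕ} {T : E →ₗ[𝕜] F}
    (b : OrthonormalBasis (Fin k) 𝕜 E) {c : Fin k → F} (hc : Orthonormal 𝕜 c) {s : Fin k → 𝕜}
    (hT : ∀ i, T (b i) = s i • c i) :
    Finset.univ.val.map (fun i : Fin k => T.singularValues i) =
      Finset.univ.val.map fun i => ‖s i‖ := by
  have hk : finrank 𝕜 E = k := by simpa using finrank_eq_card_basis b.toBasis
  have hroots := roots_charpoly_of_apply_basis (T.adjoint ∘ₗ T) b.toBasis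
    (fun i => ((‖s i‖ ^ 2 : ℝ) : 𝕜)) fun i => by
      rw [OrthonormalBasis.coe_toBasis, LinearMap.comp_apply, hT, map_smul,
        adjoint_apply_of_apply_orthonormal b hc hT, smul_smul, RCLike.star_def, RCLike.mul_conj,
        RCLike.ofReal_pow]
  rw [T.isSymmetric_adjoint_comp_self.roots_charpoly_eq_eigenvalues hk] at hroots
  have hsqrt := congrArg (Multiset.map fun z : 𝕜 => √(RCLike.re z)) hroots
  simp only [Multiset.map_map, Function.comp_def, RCLike.ofReal_re,
    Real.sqrt_sq (norm_nonneg _)] at hsqrt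
  simpa only [T.singularValues_fin hk] using hsqrt

end SingularValues

section Grassmannian

theorem exists_orthonormalBasis_span {𝕜 E ι : Type*} [RCLike 𝕜] [NormedAddCommGroup E]
    [InnerProductSpace 𝕜 E] [Fintype ι] {v : ι → E} (hv : Orthonormal 𝕜 v) :
    ∃ b : OrthonormalBasis ι 𝕜 (Submodule.span 𝕜 (range v)), ∀ i, (b i : E) = v i := by
  have hcoe : ∀ i, (Basis.span hv.linearIndependent i : E) = v i := fun i => by
    rw [Basis.span_apply]
  have hspan : Orthonormal 𝕜 (Basis.span hv.linearIndependent) := by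
    rw [← (Submodule.span 𝕜 (range v)).subtypeₗᵢ.orthonormal_comp_iff]
    simpa only [Function.comp_def, Submodule.coe_subtypeₗᵢ, Submodule.subtype_apply, hcoe] using hv
  exact ⟨(Basis.span hv.linearIndependent).toOrthonormalBasis hspan, fun i => by
    rw [Basis.coe_toOrthonormalBasis, hcoe]⟩

theorem grDist_eq_sqrt_sum_arccos {k n : ℕ} (V W : Gr k n) (u : OrthonormalBasis (Fin k) ℝ V.1)
    (w : OrthonormalBasis (Fin k) ℝ W.1) (s : Fin k → ℝ)
    (hs : ∀ i j, ⟪(u i : EuclideanSpace ℝ (Fin n)), w j⟫_ℝ = if i = j then s i else 0) :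
    grDist k n V W = √(∑ i, Real.arccos |s i| ^ 2) := by
  have hT : ∀ i, (W.1.orthogonalProjectionOnto.toLinearMap ∘ₗ V.1.subtype) (u i) = s i • w i :=
    fun i => by
      refine InnerProductSpace.ext_inner_right_basis w.toBasis fun j => ?_
      rw [OrthonormalBasis.coe_toBasis, real_inner_smul_left, w.inner_eq_ite, mul_ite, mul_one,
        mul_zero, ← hs]
      change ⟪W.1.orthogonalProjectionOnto (u i : EuclideanSpace ℝ (Fin n)), w j⟫_ℝ = _
      rw [Submodule.inner_orthogonalProjectionOnto_eq_of_mem_right]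
  have hmap := congrArg (fun m : Multiset ℝ => (m.map fun σ => Real.arccos σ ^ 2).sum)
    (map_singularValues_of_apply_orthonormal u w.orthonormal hT)
  simp only [Multiset.map_map, Function.comp_def, Real.norm_eq_abs] at hmap
  exact congrArg Real.sqrt hmap

section RotatedFrame

variable {E : Type*} [NormedAddCommGroup E] [InnerProductSpace ℝ E] {m : ℕ} {v : Fin (m + 2) → E}

/-- The frame obtained from `v 0, v 2, v 3, …` by rotating `v 0` through the angle `a` towards
`v 1`. -/
noncomputable def rotatedFrame (v : Fin (m + 2) → E) (a : ℝ) : Fin (m + 1) → E :=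
  Fin.cons (circleVec (v 0) (v 1) a) fun i => v i.succ.succ

theorem inner_rotatedFrame (hv : Orthonormal ℝ v) (a b : ℝ) (i j : Fin (m + 1)) :
    ⟪rotatedFrame v a i, rotatedFrame v b j⟫_ℝ =
      if i = j then (Fin.cons (Real.cos (a - b)) fun _ => 1 : Fin (m + 1) → ℝ) i else 0 := by
  have hv' := orthonormal_iff_ite.1 hv
  have hzero : ∀ (c : ℝ) (l : Fin m), ⟪circleVec (v 0) (v 1) c, v l.succ.succ⟫_ℝ = 0 := by
    intro c l
    rw [circleVec, inner_add_left, real_inner_smul_left, real_inner_smul_left,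
      hv.inner_eq_zero (Fin.succ_ne_zero _).symm, hv.inner_eq_zero, mul_zero, mul_zero, add_zero]
    exact fun h => Fin.succ_ne_zero l (Fin.succ_injective _ h.symm)
  cases i using Fin.cases <;> cases j using Fin.cases
  · simpa [rotatedFrame] using inner_circleVec (orthonormal_pair hv zero_ne_one) a b
  · simpa [rotatedFrame, (Fin.succ_ne_zero _).symm] using hzero a _
  · simpa [rotatedFrame, real_inner_comm] using hzero b _
  · simp [rotatedFrame, hv']

theorem orthonormal_rotatedFrame (hv : Orthonormal ℝ v) (a : ℝ) :
    Orthonormal ℝ (rotatedFrame v a) :=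
  orthonormal_iff_ite.2 fun i j => by
    rw [inner_rotatedFrame hv]
    cases i using Fin.cases <;> simp

end RotatedFrame

variable {m n : ℕ} {v : Fin (m + 2) → EuclideanSpace ℝ (Fin n)}

/-- The projective line in the Grassmannian formed by the spans of the frames `rotatedFrame v a`;
it is traversed once as `a` runs over an interval of length `π`. -/
noncomputable def grCurve (hv : Orthonormal ℝ v) (a : ℝ) : Gr (m + 1) n :=
  ⟨Submodule.span ℝ (range (rotatedFrame v a)), by
    simpa using finrank_span_eq_card (orthonormal_rotatedFrame hv a).linearIndependent⟩

theorem grDist_grCurve (hv : Orthonormal ℝ v) (a b : ℝ) :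
    grDist (m + 1) n (grCurve hv a) (grCurve hv b) = Real.arccos |Real.cos (a - b)| := by
  obtain ⟨u, hu⟩ := exists_orthonormalBasis_span (orthonormal_rotatedFrame hv a)
  obtain ⟨w, hw⟩ := exists_orthonormalBasis_span (orthonormal_rotatedFrame hv b)
  rw [grDist_eq_sqrt_sum_arccos (grCurve hv a) (grCurve hv b) u w
    (Fin.cons (Real.cos (a - b)) fun _ => 1) fun i j =>
      (congrArg₂ (inner ℝ) (hu i) (hw j)).trans (inner_rotatedFrame hv a b i j),
    Fin.sum_univ_succ]
  simp [Real.sqrt_sq (Real.arccos_nonneg _)]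

theorem lambdaPlus_grDist {k : ℕ} (hk : 1 ≤ k) (hkn : k < n) : LambdaPlus (grDist k n) = ∅ := by
  obtain ⟨m, rfl⟩ := Nat.exists_eq_add_of_le' hk
  obtain ⟨v, hv⟩ := exists_orthonormal (𝕜 := ℝ) (E := EuclideanSpace ℝ (Fin n)) (m := m + 2)
    (by rw [finrank_euclideanSpace_fin]; lia)
  exact (scaledEmbeds_circleDist_of_arccos_abs_cos (grCurve hv) (grDist_grCurve hv))
    |>.lambdaPlus_eq_empty (by norm_num) lambdaPlus_circleDist

end Grassmannian

end GaussianKernel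

theorem mainTheorem2_general :
    (∀ (X : Type*) (d : X → X → ℝ) (r : ℝ), r ≠ 0 →
      GaussianKernel.ScaledEmbeds r (GaussianKernel.sphDist 1) d →
      GaussianKernel.LambdaPlus d = ∅) ∧
    (∀ n : ℕ, 1 ≤ n → GaussianKernel.LambdaPlus (GaussianKernel.sphDist n) = ∅) ∧
    (∀ n : ℕ, 1 ≤ n → GaussianKernel.LambdaPlus (GaussianKernel.rprojDist n) = ∅) ∧
    (∀ k n : ℕ, 1 ≤ k → k < n → GaussianKernel.LambdaPlus (GaussianKernel.grDist k n) = ∅) :=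
  ⟨fun _ _ _ hr h => h.lambdaPlus_eq_empty hr (GaussianKernel.lambdaPlus_sphDist le_rfl),
    fun _ => GaussianKernel.lambdaPlus_sphDist, fun _ => GaussianKernel.lambdaPlus_rprojDist,
    fun _ _ => GaussianKernel.lambdaPlus_grDist⟩

theorem mainTheorem2 :
    (∀ (X : Type*) [MetricSpace X] (r : ℝ), 0 < r →
      GaussianKernel.ScaledEmbeds r (GaussianKernel.sphDist 1) (fun x y : X => dist x y) →
      GaussianKernel.LambdaPlus (fun x y : X => dist x y) = ∅) ∧
    (∀ n : ℕ, 1 ≤ n → GaussianKernel.LambdaPlus (GaussianKernel.sphDist n) = ∅) ∧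
    (∀ n : ℕ, 1 ≤ n → GaussianKernel.LambdaPlus (GaussianKernel.rprojDist n) = ∅) ∧
    (∀ k n : ℕ, 1 ≤ k → k < n → GaussianKernel.LambdaPlus (GaussianKernel.grDist k n) = ∅) :=
  mainTheorem2_general.imp_left fun h X _ r hr => h X _ r hr.ne'
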